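/- An $n\times n$ sign pattern is a matrix $\mathcal P=[p_{ij}]$ with entries in $\{+,-,0\}$; its qualitative class $\mathcal Q(\mathcal P)$ is the set of all real $n\times n$ matrices $A=[a_{ij}]$ with $\operatorname{sgn}(a_{ij})=p_{ij}$ for all $i,j$. The pattern $\mathcal P$ is sign nonsingular if every $A\in\mathcal Q(\mathcal P)$ is nonsingular, and $2$-consistent if every $A\in\mathcal Q(\mathcal P)$ has exactly two real eigenvalues, counted with algebraic multiplicity. The signed directed graph $D$ of $\mathcal P$ has vertex set $\{1,\dots,n\}$ and an edge $(i,j)$ of sign $p_{ij}$ whenever $p_{ij}\neq 0$. A cycle $\gamma=(i_1,\dots,i_k)$ in $D$, $k\ge 1$, consists of distinct vertices $i_1,\dots,i_k$ with $p_{i_1i_2},p_{i_2i_3},\dots,p_{i_ki_1}$ all nonzero (a loop if $k=1$); its length is $k$, its vertex set is $V(\gamma)=\{i_1,\dots,i_k\}$, and its sign is $\operatorname{sgn}(\gamma)=(-1)^{k-1}p_{i_1i_2}p_{i_2i_3}\cdots p_{i_ki_1}$. It is called even or odd according to the parity of $k$. A composite cycle $\Gamma=\gamma_1\cdots\gamma_t$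 is a product of mutually vertex-disjoint cycles; its length is the sum of their lengths and its sign is the product of their signs. For a set $S$ of vertices, $D(S)$ is the subgraph of $D$ induced by $S$. Theorem. Let $\mathcal P$ be an $n\times n$ sign pattern that is sign nonsingular and $2$-consistent, and let $D$ be its signed directed graph. Then the following hold. 1. All composite cycles of length $n$ in $D$ have the same sign. 2. $D$ contains a negative even cycle or two vertex-disjoint odd cycles (possibly both). 3. If $D$ contains a negative even cycle, then $D$ does not contain two vertex-disjoint odd cycles of the same sign. 4. If $\Gamma$ is a composite cycle of length $n$ in $D$ and $\gamma$ is an odd cycle contained in $\Gamma$ (that is, one of its factors), then every odd cycle in $D(V(\gamma))$ has the same sign as $\gamma$. -/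

import Mathlib

/-- An `n × n` sign pattern: a matrix with entries in `{+, -, 0}`. -/
abbrev SignPattern (n : ℕ) : Type := Matrix (Fin n) (Fin n) SignType

namespace SignPattern

/-- The qualitative class of `P`: all real matrices whose entries have the signs prescribed
by `P`. -/
def qualitativeClass {n : ℕ} (P : SignPattern n) : Set (Matrix (Fin n) (Fin n) ℝ) :=
  {A | ∀ i j, SignType.sign (A i j) = P i j}

/-- `P` is sign nonsingular if it requires nonsingularity. -/
def IsSignNonsingular {n : ℕ} (P : SignPattern n) : Prop :=
  ∀ A ∈ P.qualitativeClass, A.det ≠ 0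

/-- The number of real eigenvalues of a real matrix, counted with algebraic multiplicity, so that
the number of nonreal eigenvalues is `n` minus this number. -/
noncomputable def realEigenvalueCount {n : ℕ} (A : Matrix (Fin n) (Fin n) ℝ) : ℕ :=
  Multiset.card A.charpoly.roots

/-- `P` is `k`-consistent if every matrix in its qualitative class has exactly `k` real
eigenvalues. -/
def IsConsistentOf {n : ℕ} (P : SignPattern n) (k : ℕ) : Prop :=
  k ≤ n ∧ ∀ A ∈ P.qualitativeClass, realEigenvalueCount A = k

/-- A simple cycle `(i₁, …, i_k)`, `k ≥ 1`, of the signed directed graph of `P`: distinct vertices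
such that the entries of `P` at `(i₁, i₂), (i₂, i₃), …, (i_k, i₁)` are all nonzero. The case
`k = 1` is a loop. `finRotate` is the cyclic successor on the positions. -/
structure SimpleCycle {n : ℕ} (P : SignPattern n) where
  length : ℕ
  length_pos : 0 < length
  vertex : Fin length → Fin n
  vertex_injective : Function.Injective vertex
  edge_ne_zero : ∀ a, P (vertex a) (vertex (finRotate length a)) ≠ 0

namespace SimpleCycle

/-- The vertex set of a simple cycle. -/
def support {n : ℕ} {P : SignPattern n} (γ : SimpleCycle P) : Set (Fin n) :=
  Set.range γ.vertex

/-- The sign of a simple cycle of length `k`: `(-1) ^ (k - 1)` times the product of the signs of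
its edges. -/
def sign {n : ℕ} {P : SignPattern n} (γ : SimpleCycle P) : SignType :=
  (-1) ^ (γ.length - 1) * ∏ a, P (γ.vertex a) (γ.vertex (finRotate γ.length a))

end SimpleCycle

/-- A composite cycle: a finite family of mutually vertex disjoint simple cycles. -/
structure CompositeCycle {n : ℕ} (P : SignPattern n) where
  card : ℕ
  cycle : Fin card → SimpleCycle P
  disjoint : ∀ p q, p ≠ q → Disjoint (cycle p).support (cycle q).support

namespace CompositeCycle

/-- The length of a composite cycle: the sum of the lengths of its simple cycles. -/
def length {n : ℕ} {P : SignPattern n} (Γ : CompositeCycle P) : ℕ :=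
  ∑ p, (Γ.cycle p).length

/-- The sign of a composite cycle: the product of the signs of its simple cycles. -/
def sign {n : ℕ} {P : SignPattern n} (Γ : CompositeCycle P) : SignType :=
  ∏ p, (Γ.cycle p).sign

end CompositeCycle

end SignPattern

/-! The qualitative class is convex, so by sign nonsingularity the determinant has one sign on it,
`detSign`. A monic real polynomial without real roots is positive and has even degree; hence n is
even and the determinant is a positive multiple of the product of the two real eigenvalues.

Entries may be shrunk to zero in the limit (`IsSubordinate`), so matrices supported on chosen cycles
can be tested. A negative even cycle has eigenvalues 1 and -1, forcing `detSign = -1`; two disjoint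
odd cycles give real eigenvalues with the signs of the cycles, so `detSign` is the product of these
signs (`detSign_eq_of_sign_changes`). A spanning composite cycle has determinant equal to its sign,
which gives item 1. Items 3 and 4 compare these values of `detSign`.

For item 2, a permutation along nonzero entries gives a limit matrix, which still has a real
eigenvector. An orbit meeting its support is either a negative even cycle or an odd one, and since n
is even a second odd orbit then exists. -/

/-! ### Monic real polynomials with few real roots. -/

open Polynomial in
theorem Polynomial.Monic.eval_pos_of_roots_eq_zero {q : ℝ[X]} (hq : q.Monic) (h : q.roots = 0)
    (x : ℝ) : 0 < q.eval x := by
  refine zero_lt_eval_of_roots_lt_of_leadingCoeff_nonneg (fun y hy => ?_) (by simp [hq.leadingCoeff])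
  have : y ∈ q.roots := (mem_roots hq.ne_zero).2 hy
  simp [h] at this

open Polynomial in
-- In odd degree -q(-X) would also be monic without roots, so both q(0) and -q(0) would be positive.
theorem Polynomial.Monic.even_natDegree_of_roots_eq_zero {q : ℝ[X]} (hq : q.Monic)
    (h : q.roots = 0) : Even q.natDegree := by
  by_contra hodd
  rw [Nat.not_even_iff_odd] at hodd
  have hm : (-(q.comp (-X))).Monic := by
    have : (-(q.comp (-X))).leadingCoeff = 1 := by
      rw [leadingCoeff_neg, leadingCoeff_comp (by simp)]
      simp [hq.leadingCoeff, hodd.neg_one_pow]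
    exact this
  have hr : (-(q.comp (-X))).roots = 0 := by
    rw [Multiset.eq_zero_iff_forall_notMem]
    intro y hy
    have h1 := (mem_roots hm.ne_zero).1 hy
    have h2 := hq.eval_pos_of_roots_eq_zero h (-y)
    simp [IsRoot] at h1
    exact h2.ne' h1
  have h1 := hm.eval_pos_of_roots_eq_zero hr 0
  have h2 := hq.eval_pos_of_roots_eq_zero h 0
  simp at h1
  linarith

open Polynomial in
/-- A monic real polynomial with exactly two real roots is, up to a positive factor, the product
of the two corresponding linear factors. -/
theorem Polynomial.Monic.even_natDegree_and_eval_eq_of_card_roots_eq_two {p : ℝ[X]} (hp : p.Monic)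
    (h : p.roots.card = 2) :
    Even p.natDegree ∧ ∀ r s, p.IsRoot r → p.IsRoot s → r ≠ s →
      ∀ x, ∃ c > 0, p.eval x = (x - r) * (x - s) * c := by
  obtain ⟨q, hpq, hdeg, hq⟩ := exists_prod_multiset_X_sub_C_mul p
  have hqm : q.Monic :=
    (monic_multisetProd_X_sub_C p.roots).of_mul_monic_left (by rw [hpq]; exact hp)
  have heven := hqm.even_natDegree_of_roots_eq_zero hq
  refine ⟨by rw [← hdeg, h]; exact even_two.add heven, fun r s hr hs hrs x => ?_⟩
  have hr' : r ∈ p.roots := (mem_roots hp.ne_zero).2 hr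
  have hs' : s ∈ p.roots := (mem_roots hp.ne_zero).2 hs
  have hroots : p.roots = {r, s} := by
    symm
    apply Multiset.eq_of_le_of_card_le
    · rw [Multiset.le_iff_subset (by simp [hrs])]
      intro y hy
      simp at hy
      rcases hy with rfl | rfl <;> assumption
    · simp [h]
  refine ⟨q.eval x, hqm.eval_pos_of_roots_eq_zero hq x, ?_⟩
  conv_lhs => rw [← hpq, hroots]
  simp

/-! ### Determinants of cyclic matrices. -/

theorem Equiv.Perm.eq_one_or_eq_finRotate {k : ℕ} (σ : Equiv.Perm (Fin k))
    (h : ∀ a, σ a = a ∨ σ a = finRotate k a) : σ = 1 ∨ σ = finRotate k := by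
  by_cases h1 : σ = 1
  · exact Or.inl h1
  right
  obtain ⟨a, ha⟩ : ∃ a, σ a ≠ a := by
    by_contra! hc
    exact h1 (Equiv.ext hc)
  cases k with
  | zero => exact a.elim0
  | succ k =>
    have step : ∀ b, σ b ≠ b → σ (b + 1) ≠ b + 1 := by
      intro b hb hb1
      have h2 : σ b = b + 1 := by simpa using (h b).resolve_left hb
      have h3 : b = b + 1 := σ.injective (h2.trans hb1.symm)
      exact hb (h2.trans h3.symm)
    have all : ∀ j : Fin (k + 1), σ (a + j) ≠ a + j := by
      intro j
      induction j using Fin.induction with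
      | zero => simpa using ha
      | succ j ih => simpa only [add_assoc, Fin.coeSucc_eq_succ] using step _ ih
    ext1 b
    refine (h b).resolve_left ?_
    simpa using all (b - a)

namespace Matrix

variable {R : Type*} [CommRing R]

/-- Only the identity and the full rotation contribute to the Leibniz sum. They coincide for k = 1,
which is treated separately. -/
theorem det_scalar_sub_cyclic {k : ℕ} (hk : 0 < k) (w : Fin k → R) (x : R) :
    (Matrix.scalar (Fin k) x - Matrix.of fun a b => if b = finRotate k a then w a else 0).det
      = x ^ k - ∏ a, w a := by
  rw [← det_transpose, det_apply']
  rcases Nat.lt_or_ge 1 k with hk1 | hk1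
  · have hne : (1 : Equiv.Perm (Fin k)) ≠ finRotate k := by
      obtain ⟨k, rfl⟩ : ∃ m, k = m + 2 := ⟨k - 2, by omega⟩
      intro h
      have := congrArg (fun σ : Equiv.Perm (Fin (k + 2)) => σ 0) h
      simp at this
    have hfix : ∀ a, finRotate k a ≠ a := by
      obtain ⟨k, rfl⟩ : ∃ m, k = m + 2 := ⟨k - 2, by omega⟩
      intro a
      simp
    rw [← Finset.sum_subset (Finset.subset_univ {1, finRotate k}), Finset.sum_pair hne]
    · have e1 : ∀ a : Fin k, a ≠ finRotate k a := fun a => (hfix a).symm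
      simp only [Equiv.Perm.sign_one, transpose_apply, sub_apply, scalar_apply, diagonal_apply,
        of_apply, Equiv.Perm.one_apply, e1, if_false, if_true, sign_finRotate]
      simp only [sub_zero, zero_sub, Finset.prod_neg]
      obtain ⟨k, rfl⟩ : ∃ m, k = m + 1 := ⟨k - 1, by omega⟩
      simp [pow_succ]
      rw [← mul_assoc, ← mul_pow]
      simp [sub_eq_add_neg]
    · intro σ _ hσ
      by_contra hne0
      apply hσ
      have : σ = 1 ∨ σ = finRotate k := by
        apply Equiv.Perm.eq_one_or_eq_finRotate
        intro a
        by_contra! hc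
        apply hne0
        rw [Finset.prod_eq_zero (Finset.mem_univ a), mul_zero]
        rw [transpose_apply, sub_apply, of_apply, if_neg hc.2, scalar_apply,
          diagonal_apply_ne _ hc.1.symm, sub_zero]
      simpa using this
  · obtain rfl : k = 1 := by omega
    simp [Matrix.scalar_apply]

end Matrix

/-! ### The qualitative class and its limits. -/

namespace SignPattern

variable {n : ℕ} {P : SignPattern n}

/-- The real matrix with entries `0`, `1`, `-1` determined by a sign pattern. -/
def toReal (P : SignPattern n) : Matrix (Fin n) (Fin n) ℝ := fun i j => ((P i j : SignType) : ℝ)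

theorem sign_cast_real (s : SignType) : SignType.sign ((s : SignType) : ℝ) = s := by
  cases s <;> simp

theorem toReal_mem (P : SignPattern n) : P.toReal ∈ P.qualitativeClass :=
  fun _ _ => sign_cast_real _

/-- Entrywise, `A` is a nonnegative multiple of the sign pattern `P`. -/
def IsSubordinate (P : SignPattern n) (A : Matrix (Fin n) (Fin n) ℝ) : Prop :=
  ∀ i j, ∃ c : ℝ, 0 ≤ c ∧ A i j = c * ((P i j : SignType) : ℝ)

theorem IsSubordinate.add {A B : Matrix (Fin n) (Fin n) ℝ} (hA : P.IsSubordinate A)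
    (hB : P.IsSubordinate B) : P.IsSubordinate (A + B) := fun i j => by
  obtain ⟨c, hc, h⟩ := hA i j
  obtain ⟨d, hd, h'⟩ := hB i j
  exact ⟨c + d, add_nonneg hc hd, by rw [Matrix.add_apply, h, h', add_mul]⟩

theorem IsSubordinate.add_smul_mem {A : Matrix (Fin n) (Fin n) ℝ} (hA : P.IsSubordinate A) {t : ℝ}
    (ht : 0 < t) : A + t • P.toReal ∈ P.qualitativeClass := fun i j => by
  obtain ⟨c, hc, h⟩ := hA i j
  have : (A + t • P.toReal) i j = (c + t) * ((P i j : SignType) : ℝ) := by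
    simp [h, toReal, add_mul]
  rw [this, sign_mul, sign_pos (by linarith), one_mul, sign_cast_real]

theorem convex_qualitativeClass (P : SignPattern n) : Convex ℝ P.qualitativeClass := by
  have h : ∀ s : SignType, Convex ℝ {x : ℝ | SignType.sign x = s} := by
    intro s
    cases s
    · have : {x : ℝ | SignType.sign x = SignType.zero} = {0} := by
        ext x; exact sign_eq_zero_iff
      rw [this]; exact convex_singleton 0
    · have : {x : ℝ | SignType.sign x = SignType.neg} = Set.Iio 0 := by
        ext x; exact sign_eq_neg_one_iff
      rw [this]; exact convex_Iio 0
    · have : {x : ℝ | SignType.sign x = SignType.pos} = Set.Ioi 0 := by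
        ext x; exact sign_eq_one_iff
      rw [this]; exact convex_Ioi 0
  intro A hA B hB a b ha hb hab i j
  exact h (P i j) (hA i j) (hB i j) ha hb hab

/-- The common sign of the determinants of the matrices in a sign nonsingular pattern. -/
noncomputable def detSign (P : SignPattern n) : SignType := SignType.sign P.toReal.det

theorem IsSignNonsingular.detSign_ne_zero (h : P.IsSignNonsingular) : P.detSign ≠ 0 :=
  sign_ne_zero.2 (h _ P.toReal_mem)

theorem IsSignNonsingular.sign_det (h : P.IsSignNonsingular) {A : Matrix (Fin n) (Fin n) ℝ}
    (hA : A ∈ P.qualitativeClass) : SignType.sign A.det = P.detSign := by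
  have hc : IsPreconnected (Matrix.det '' P.qualitativeClass) :=
    P.convex_qualitativeClass.isPreconnected.image _ (Continuous.matrix_det continuous_id).continuousOn
  have h0 : (0 : ℝ) ∉ Matrix.det '' P.qualitativeClass := by
    rintro ⟨B, hB, hB0⟩
    exact h B hB hB0
  have hA1 := Set.mem_image_of_mem Matrix.det hA
  have hP1 := Set.mem_image_of_mem Matrix.det P.toReal_mem
  have hoc := hc.ordConnected
  rcases lt_or_gt_of_ne (h A hA) with h1 | h1 <;>
    rcases lt_or_gt_of_ne (h _ P.toReal_mem) with h2 | h2
  · simp [detSign, sign_neg h1, sign_neg h2]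
  · exact absurd (hoc.out hA1 hP1 ⟨h1.le, h2.le⟩) h0
  · exact absurd (hoc.out hP1 hA1 ⟨h2.le, h1.le⟩) h0
  · simp [detSign, sign_pos h1, sign_pos h2]

/-- A small positive multiple of `toReal` moves `A` into the class without changing the sign of its
nonzero determinant. -/
theorem IsSignNonsingular.sign_det_of_isSubordinate (h : P.IsSignNonsingular)
    {A : Matrix (Fin n) (Fin n) ℝ} (hA : P.IsSubordinate A) (hdet : A.det ≠ 0) :
    SignType.sign A.det = P.detSign := by
  have hcont : Continuous fun t : ℝ => (A + t • P.toReal).det := by fun_prop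
  have ht : Filter.Tendsto (fun t : ℝ => (A + t • P.toReal).det * A.det) (nhds 0)
      (nhds (A.det * A.det)) := by
    have := (hcont.mul_const A.det).tendsto 0
    simpa using this
  have hpos := ht.eventually (lt_mem_nhds (mul_self_pos.2 hdet))
  obtain ⟨t, h1, h2⟩ := ((hpos.filter_mono nhdsWithin_le_nhds).and
    (self_mem_nhdsWithin : Set.Ioi (0 : ℝ) ∈ nhdsWithin 0 (Set.Ioi 0))).exists
  rw [← h.sign_det (hA.add_smul_mem h2)]
  rcases pos_and_pos_or_neg_and_neg_of_mul_pos h1 with ⟨ha, hb⟩ | ⟨ha, hb⟩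
  · rw [sign_pos ha, sign_pos hb]
  · rw [sign_neg ha, sign_neg hb]

/-! ### Real eigenvalues of limit matrices. -/

theorem IsConsistentOf.even_of_two (h : P.IsConsistentOf 2) : Even n := by
  have := ((P.toReal.charpoly_monic).even_natDegree_and_eval_eq_of_card_roots_eq_two
    (h.2 _ P.toReal_mem)).1
  simpa using this

/-- A sign change of the characteristic polynomial persists in the qualitative class. -/
theorem eventually_charpoly_sign_change {A : Matrix (Fin n) (Fin n) ℝ} {u v : ℝ}
    (h : A.charpoly.eval u * A.charpoly.eval v < 0) :
    ∀ᶠ t in nhdsWithin (0 : ℝ) (Set.Ioi 0), ∃ r ∈ Set.uIcc u v,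
      (A + t • P.toReal).charpoly.IsRoot r := by
  have hcont : ∀ x : ℝ, Continuous fun t : ℝ => (A + t • P.toReal).charpoly.eval x := by
    intro x
    simp_rw [Matrix.eval_charpoly]
    fun_prop
  have ht : Filter.Tendsto (fun t : ℝ => (A + t • P.toReal).charpoly.eval u *
      (A + t • P.toReal).charpoly.eval v) (nhds 0)
      (nhds (A.charpoly.eval u * A.charpoly.eval v)) := by
    have := ((hcont u).tendsto 0).mul ((hcont v).tendsto 0)
    simpa using this
  filter_upwards [(ht.eventually (gt_mem_nhds h)).filter_mono nhdsWithin_le_nhds] with t hneg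
  have hivt := intermediate_value_uIcc
    ((A + t • P.toReal).charpoly.continuous.continuousOn (s := Set.uIcc u v))
  obtain ⟨r, hr, hr0⟩ := hivt (show (0 : ℝ) ∈ _ by
    rcases mul_neg_iff.1 hneg with ⟨h1, h2⟩ | ⟨h1, h2⟩
    · exact Set.mem_uIcc.2 (Or.inr ⟨h2.le, h1.le⟩)
    · exact Set.mem_uIcc.2 (Or.inl ⟨h1.le, h2.le⟩))
  exact ⟨r, hr, hr0⟩

theorem sign_eq_of_mem_uIcc {u v r : ℝ} (huv : 0 < u * v) (hr : r ∈ Set.uIcc u v) :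
    SignType.sign r = SignType.sign u := by
  rcases pos_and_pos_or_neg_and_neg_of_mul_pos huv with ⟨hu, hv⟩ | ⟨hu, hv⟩ <;>
    rcases Set.mem_uIcc.1 hr with h | h
  · rw [sign_pos hu, sign_pos (hu.trans_le h.1)]
  · rw [sign_pos hu, sign_pos (hv.trans_le h.1)]
  · rw [sign_neg hu, sign_neg (h.2.trans_lt hv)]
  · rw [sign_neg hu, sign_neg (h.2.trans_lt hu)]

/-- If the characteristic polynomial of a matrix subordinate to `P` changes sign on two disjoint
intervals avoiding `0`, then these locate the two real eigenvalues of nearby matrices of the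
qualitative class, and hence determine the sign of the determinant. -/
theorem detSign_eq_of_sign_changes (hns : P.IsSignNonsingular) (hP : P.IsConsistentOf 2)
    {A : Matrix (Fin n) (Fin n) ℝ} (hA : P.IsSubordinate A) {u v u' v' : ℝ}
    (huv : 0 < u * v) (huv' : 0 < u' * v') (hdisj : Disjoint (Set.uIcc u v) (Set.uIcc u' v'))
    (h : A.charpoly.eval u * A.charpoly.eval v < 0)
    (h' : A.charpoly.eval u' * A.charpoly.eval v' < 0) :
    P.detSign = SignType.sign u * SignType.sign u' := by
  obtain ⟨t, ⟨⟨r, hr, hr0⟩, s, hs, hs0⟩, ht⟩ :=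
    (((eventually_charpoly_sign_change (P := P) h).and
      (eventually_charpoly_sign_change (P := P) h')).and
      (self_mem_nhdsWithin : Set.Ioi (0 : ℝ) ∈ nhdsWithin 0 (Set.Ioi 0))).exists
  have hmem := hA.add_smul_mem ht
  have hrs : r ≠ s := fun hrs => Set.disjoint_left.1 hdisj hr (hrs ▸ hs)
  obtain ⟨c, hc, hev⟩ := ((Matrix.charpoly_monic
    (A + t • P.toReal)).even_natDegree_and_eval_eq_of_card_roots_eq_two
    (hP.2 _ hmem)).2 r s hr0 hs0 hrs 0
  rw [← hns.sign_det hmem, ← sign_eq_of_mem_uIcc huv hr, ← sign_eq_of_mem_uIcc huv' hs,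
    ← sign_mul]
  -- At 0 the characteristic polynomial is the determinant, since n is even.
  have hdet : (A + t • P.toReal).det = r * s * c := by
    rw [Matrix.eval_charpoly, map_zero, zero_sub, Matrix.det_neg, Fintype.card_fin,
      hP.even_of_two.neg_one_pow, one_mul] at hev
    rw [hev]; ring
  rw [hdet, sign_mul, sign_pos hc, mul_one]

/-- Nearby matrices of the class have real unit eigenvectors; compactness of the sphere yields a
limit. -/
theorem exists_eigenvector_of_isSubordinate (hP : P.IsConsistentOf 2)
    {A : Matrix (Fin n) (Fin n) ℝ} (hA : P.IsSubordinate A) :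
    ∃ (x : ℝ) (v : Fin n → ℝ), v ≠ 0 ∧ A.mulVec v = x • v := by
  have key : ∀ t : ℝ, 0 < t → ∃ (x : ℝ) (v : Fin n → ℝ), v ∈ Metric.sphere (0 : Fin n → ℝ) 1 ∧
      (A + t • P.toReal).mulVec v = x • v := by
    intro t ht
    have hcard := hP.2 _ (hA.add_smul_mem ht)
    obtain ⟨x, hx⟩ : ∃ x, x ∈ (A + t • P.toReal).charpoly.roots := by
      apply Multiset.exists_mem_of_ne_zero
      intro h0
      simp [realEigenvalueCount, h0] at hcard
    have hx0 := (Polynomial.mem_roots (Matrix.charpoly_monic _).ne_zero).1 hx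
    rw [Polynomial.IsRoot, Matrix.eval_charpoly] at hx0
    obtain ⟨v, hv, hv0⟩ := Matrix.exists_mulVec_eq_zero_iff.2 hx0
    have hv1 : (A + t • P.toReal).mulVec v = x • v := by
      rw [Matrix.sub_mulVec, sub_eq_zero] at hv0
      rw [← hv0]
      ext i
      simp [Matrix.scalar_apply, Matrix.mulVec_diagonal]
    refine ⟨x, ‖v‖⁻¹ • v, ?_, ?_⟩
    · simp [norm_smul, norm_ne_zero_iff.2 hv]
    · rw [Matrix.mulVec_smul, hv1, smul_comm]
  have hpos : ∀ m : ℕ, (0 : ℝ) < 1 / ((m : ℝ) + 1) := fun m => by positivity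
  choose x v hv hxv using fun m : ℕ => key _ (hpos m)
  obtain ⟨w, hw, φ, hφ, hlim⟩ := (isCompact_sphere (0 : Fin n → ℝ) 1).tendsto_subseq hv
  have hw0 : w ≠ 0 := by
    rintro rfl
    simp at hw
  obtain ⟨i, hi⟩ := Function.ne_iff.1 hw0
  have ht : Filter.Tendsto (fun m => 1 / (((φ m : ℕ) : ℝ) + 1)) Filter.atTop (nhds 0) :=
    tendsto_one_div_add_atTop_nhds_zero_nat.comp hφ.tendsto_atTop
  have hcont : Continuous fun q : ℝ × (Fin n → ℝ) => (A + q.1 • P.toReal).mulVec q.2 := by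
    fun_prop
  have hAv : Filter.Tendsto (fun m => x (φ m) • v (φ m)) Filter.atTop (nhds (A.mulVec w)) := by
    have := (hcont.tendsto (0, w)).comp (ht.prodMk_nhds hlim)
    simp only [zero_smul, add_zero] at this
    refine this.congr fun m => ?_
    simpa using hxv (φ m)
  have hcoord : ∀ j, Filter.Tendsto (fun m => x (φ m) * v (φ m) j) Filter.atTop
      (nhds (A.mulVec w j)) := fun j => by
    simpa using (tendsto_pi_nhds.1 hAv j)
  have hvj : ∀ j, Filter.Tendsto (fun m => v (φ m) j) Filter.atTop (nhds (w j)) := fun j =>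
    tendsto_pi_nhds.1 hlim j
  refine ⟨A.mulVec w i / w i, w, hw0, ?_⟩
  ext j
  -- Cross-multiplying coordinates eliminates the eigenvalues, whose convergence is then not needed.
  have h1 : A.mulVec w j * w i = A.mulVec w i * w j := by
    refine tendsto_nhds_unique ((hcoord j).mul (hvj i))
      (((hcoord i).mul (hvj j)).congr fun m => ?_)
    ring
  have hi' : w i ≠ 0 := hi
  rw [Pi.smul_apply, smul_eq_mul, div_mul_eq_mul_div, eq_div_iff hi', h1]

end SignPattern

theorem val_finRotate {k : ℕ} (a : Fin k) : (finRotate k a : ℕ) = (a + 1) % k := by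
  cases k with
  | zero => exact a.elim0
  | succ k => rw [finRotate_apply, Fin.val_add, Fin.val_one', Nat.add_mod_mod]

/-! ### Matrices supported on one or two cycles. -/

namespace SignPattern

variable {n : ℕ} {P : SignPattern n}

theorem cast_prod {ι : Type*} [Fintype ι] (f : ι → SignType) :
    ((∏ a, f a : SignType) : ℝ) = ∏ a, ((f a : SignType) : ℝ) :=
  map_prod (SignType.castHom (α := ℝ)) f Finset.univ

namespace SimpleCycle

/-- The product of the signs of the edges of a cycle. -/
def edgeProd (γ : SimpleCycle P) : SignType :=
  ∏ a, P (γ.vertex a) (γ.vertex (finRotate γ.length a))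

theorem sign_of_odd {γ : SimpleCycle P} (h : Odd γ.length) : γ.sign = γ.edgeProd := by
  rw [sign, (Nat.Odd.sub_odd h odd_one).neg_one_pow, one_mul, edgeProd]

theorem sign_of_even {γ : SimpleCycle P} (h : Even γ.length) : γ.sign = -γ.edgeProd := by
  rw [sign, (Nat.Even.sub_odd γ.length_pos h odd_one).neg_one_pow, neg_one_mul, edgeProd]

theorem edgeProd_eq_one_or (γ : SimpleCycle P) : γ.edgeProd = 1 ∨ γ.edgeProd = -1 := by
  have h : γ.edgeProd ≠ 0 := Finset.prod_ne_zero_iff.2 fun a _ => γ.edge_ne_zero a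
  revert h
  generalize γ.edgeProd = s
  decide +revert

/-- The real matrix supported on the edges of a cycle, with entries of absolute value `c`. -/
noncomputable def weightedMatrix (γ : SimpleCycle P) (c : ℝ) : Matrix (Fin n) (Fin n) ℝ :=
  (Matrix.of fun i a => if i = γ.vertex a then
      c * ((P (γ.vertex a) (γ.vertex (finRotate γ.length a)) : SignType) : ℝ) else 0) *
    (Matrix.of fun a j => if j = γ.vertex (finRotate γ.length a) then (1 : ℝ) else 0)

theorem isSubordinate_weightedMatrix (γ : SimpleCycle P) {c : ℝ} (hc : 0 ≤ c) :
    P.IsSubordinate (γ.weightedMatrix c) := fun i j => by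
  refine ⟨∑ a, if i = γ.vertex a ∧ j = γ.vertex (finRotate γ.length a) then c else 0,
    Finset.sum_nonneg fun a _ => by split_ifs <;> simp [hc], ?_⟩
  rw [weightedMatrix, Matrix.mul_apply, Finset.sum_mul]
  refine Finset.sum_congr rfl fun a _ => ?_
  simp only [Matrix.of_apply]
  by_cases h1 : i = γ.vertex a <;> by_cases h2 : j = γ.vertex (finRotate γ.length a) <;>
    simp [h1, h2, -finRotate_apply]

/-- Swapping the two factors of `weightedMatrix` leaves a cyclic matrix of size `γ.length`. Powers
of x on both sides avoid the exponent n - `γ.length`. -/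
theorem pow_mul_eval_charpoly (γ : SimpleCycle P) (c x : ℝ) :
    x ^ γ.length * (γ.weightedMatrix c).charpoly.eval x
      = x ^ n * (x ^ γ.length - c ^ γ.length * ((γ.edgeProd : SignType) : ℝ)) := by
  have h := congrArg (Polynomial.eval x) (Matrix.charpoly_mul_comm'
    (Matrix.of fun (i : Fin n) a => if i = γ.vertex a then
      c * ((P (γ.vertex a) (γ.vertex (finRotate γ.length a)) : SignType) : ℝ) else 0)
    (Matrix.of fun a j => if j = γ.vertex (finRotate γ.length a) then (1 : ℝ) else 0))
  rw [Polynomial.eval_mul, Polynomial.eval_mul, Polynomial.eval_pow, Polynomial.eval_pow,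
    Polynomial.eval_X, Fintype.card_fin, Fintype.card_fin] at h
  rw [weightedMatrix, h, Matrix.eval_charpoly]
  congr 1
  -- The swapped product carries at position a the weight of the next edge.
  have hw : ∏ a, (c * ((P (γ.vertex (finRotate γ.length a))
      (γ.vertex (finRotate γ.length (finRotate γ.length a))) : SignType) : ℝ)) =
      c ^ γ.length * ((γ.edgeProd : SignType) : ℝ) := by
    rw [Equiv.prod_comp (finRotate γ.length) (fun a => c * ((P (γ.vertex a)
      (γ.vertex (finRotate γ.length a)) : SignType) : ℝ)), Finset.prod_mul_distrib, edgeProd,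
      cast_prod]
    simp
  rw [← hw, ← Matrix.det_scalar_sub_cyclic γ.length_pos]
  congr 2
  ext a b
  simp only [Matrix.mul_apply, Matrix.of_apply, ite_mul, one_mul, zero_mul, Finset.sum_ite_eq',
    Finset.mem_univ, if_true, γ.vertex_injective.eq_iff]
  by_cases hb : finRotate γ.length a = b
  · subst hb; simp
  · rw [if_neg hb, if_neg (Ne.symm hb)]

theorem weightedMatrix_mul_eq_zero {γ γ' : SimpleCycle P} (h : Disjoint γ.support γ'.support)
    (c c' : ℝ) : γ.weightedMatrix c * γ'.weightedMatrix c' = 0 := by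
  rw [weightedMatrix, weightedMatrix, Matrix.mul_assoc, ← Matrix.mul_assoc (Matrix.of _) _
    (Matrix.of _)]
  convert Matrix.mul_zero _
  convert Matrix.zero_mul _
  ext a b
  rw [Matrix.mul_apply]
  refine Finset.sum_eq_zero fun j _ => ?_
  simp only [Matrix.of_apply]
  split_ifs with h1 h2
  · exact absurd (h1.symm.trans h2)
      (Set.disjoint_left.1 h ⟨_, rfl⟩ |> fun hn he => hn ⟨b, he.symm⟩)
  all_goals simp

/-- If AB = 0 then (x - A)(x - B) = x(x - A - B). -/
theorem pow_mul_eval_charpoly_add {γ γ' : SimpleCycle P} (h : Disjoint γ.support γ'.support)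
    (c c' x : ℝ) :
    x ^ n * (γ.weightedMatrix c + γ'.weightedMatrix c').charpoly.eval x =
      (γ.weightedMatrix c).charpoly.eval x * (γ'.weightedMatrix c').charpoly.eval x := by
  have hs : x ^ n = (Matrix.scalar (Fin n) x).det := by simp [Matrix.scalar_apply]
  simp only [Matrix.eval_charpoly]
  rw [hs, ← Matrix.det_mul, ← Matrix.det_mul]
  congr 1
  have hcomm := (Matrix.scalar_commute x (fun r => mul_comm x r) (γ.weightedMatrix c)).eq
  rw [sub_mul, mul_sub, mul_sub, mul_sub, weightedMatrix_mul_eq_zero h, mul_add, hcomm]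
  abel

/-- A negative even cycle forces one positive and one negative eigenvalue. -/
theorem detSign_eq_neg_one_of_even (hns : P.IsSignNonsingular) (hP : P.IsConsistentOf 2)
    {γ : SimpleCycle P} (he : Even γ.length) (hγ : γ.sign = -1) : P.detSign = -1 := by
  have hprod : γ.edgeProd = 1 := by
    rw [sign_of_even he] at hγ
    simpa using hγ
  have hf : ∀ x, x ^ γ.length * (γ.weightedMatrix 1).charpoly.eval x =
      x ^ n * (x ^ γ.length - 1) := fun x => by
    rw [pow_mul_eval_charpoly, hprod]
    simp
  have hlen : γ.length ≠ 0 := γ.length_pos.ne'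
  have key : (γ.weightedMatrix 1).charpoly.eval 2 *
      (γ.weightedMatrix 1).charpoly.eval (1 / 2) < 0 := by
    have h2 := hf 2
    have h3 := hf (1 / 2)
    have e : (γ.weightedMatrix 1).charpoly.eval 2 * (γ.weightedMatrix 1).charpoly.eval (1 / 2) =
        (2 ^ γ.length - 1) * ((1 / 2) ^ γ.length - 1) := by
      have := congrArg₂ (· * ·) h2 h3
      rw [mul_mul_mul_comm, mul_mul_mul_comm (2 ^ n), ← mul_pow, ← mul_pow] at this
      norm_num at this ⊢
      exact this
    rw [e]
    exact mul_neg_of_pos_of_neg (sub_pos.2 (one_lt_pow₀ (by norm_num) hlen))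
      (sub_neg.2 (pow_lt_one₀ (by norm_num) (by norm_num) hlen))
  have hneg : ∀ x, x ≠ 0 → (γ.weightedMatrix 1).charpoly.eval (-x) =
      (γ.weightedMatrix 1).charpoly.eval x := fun x hx => by
    have h1 := hf x
    have h2 := hf (-x)
    rw [he.neg_pow, hP.even_of_two.neg_pow, ← h1] at h2
    exact mul_left_cancel₀ (pow_ne_zero _ hx) h2
  -- The intervals isolate the eigenvalues 1 and -1.
  have := detSign_eq_of_sign_changes hns hP (γ.isSubordinate_weightedMatrix zero_le_one)
    (u := 2) (v := 1 / 2) (u' := -2) (v' := -(1 / 2)) (by norm_num) (by norm_num)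
    (by
      rw [Set.disjoint_left]
      intro y hy hy'
      rw [Set.uIcc_of_ge (by norm_num)] at hy
      rw [Set.uIcc_of_le (by norm_num)] at hy'
      linarith [hy.1, hy'.2]) key
    (by rw [hneg 2 (by norm_num), hneg (1 / 2) (by norm_num)]; exact key)
  rw [this, sign_pos (by norm_num), sign_neg (by norm_num), one_mul]

/-- Odd powers are strictly increasing, so sign changes can be read off linear factors. -/
theorem sign_pow_sub_mul_pow_sub {k : ℕ} (hk : Odd k) (x y b : ℝ) :
    SignType.sign ((x ^ k - b ^ k) * (y ^ k - b ^ k)) = SignType.sign ((x - b) * (y - b)) := by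
  have h : ∀ z : ℝ, SignType.sign (z ^ k - b ^ k) = SignType.sign (z - b) := fun z => by
    rcases lt_trichotomy z b with hz | rfl | hz
    · rw [sign_neg (sub_neg.2 hz), sign_neg (sub_neg.2 (hk.strictMono_pow hz))]
    · simp
    · rw [sign_pos (sub_pos.2 hz), sign_pos (sub_pos.2 (hk.strictMono_pow hz))]
  rw [sign_mul, sign_mul, h, h]

/-- Two disjoint odd cycles force two real eigenvalues with the signs of the cycles. -/
theorem detSign_eq_of_odd (hns : P.IsSignNonsingular) (hP : P.IsConsistentOf 2)
    {γ γ' : SimpleCycle P} (ho : Odd γ.length) (ho' : Odd γ'.length)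
    (hd : Disjoint γ.support γ'.support) : P.detSign = γ.sign * γ'.sign := by
  rw [sign_of_odd ho, sign_of_odd ho']
  -- Weights 1 and 4 keep the eigenvalues s and 4s' apart even when s = s'; the intervals below
  -- isolate them.
  set A := γ.weightedMatrix 1 + γ'.weightedMatrix 4 with hA
  set s : ℝ := ((γ.edgeProd : SignType) : ℝ) with hs
  set s' : ℝ := ((γ'.edgeProd : SignType) : ℝ) with hs'
  have hs1 : s = 1 ∨ s = -1 := by
    rcases γ.edgeProd_eq_one_or with h | h <;> simp [hs, h]
  have hs1' : s' = 1 ∨ s' = -1 := by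
    rcases γ'.edgeProd_eq_one_or with h | h <;> simp [hs', h]
  have hpow : s = s ^ γ.length := by
    rcases hs1 with h | h <;> simp [h, ho.neg_one_pow]
  have hpow' : 4 ^ γ'.length * s' = (4 * s') ^ γ'.length := by
    rcases hs1' with h | h <;> simp [h, ho'.neg_pow]
  have hf : ∀ x, x ^ (n + γ.length + γ'.length) * A.charpoly.eval x =
      x ^ (n + n) * ((x ^ γ.length - s ^ γ.length) * (x ^ γ'.length - (4 * s') ^ γ'.length)) := by
    intro x
    have h1 := pow_mul_eval_charpoly_add hd 1 4 x
    have h2 := γ.pow_mul_eval_charpoly 1 x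
    have h3 := γ'.pow_mul_eval_charpoly 4 x
    rw [one_pow, one_mul, ← hs, hpow] at h2
    rw [← hs', hpow'] at h3
    calc _ = x ^ γ.length * x ^ γ'.length * (x ^ n * A.charpoly.eval x) := by ring
      _ = (x ^ γ.length * (γ.weightedMatrix 1).charpoly.eval x) *
          (x ^ γ'.length * (γ'.weightedMatrix 4).charpoly.eval x) := by rw [h1]; ring
      _ = _ := by rw [h2, h3]; ring
  have hsign : ∀ x y, 0 < x * y → (x - s) * (y - s) * ((x - 4 * s') * (y - 4 * s')) < 0 →
      A.charpoly.eval x * A.charpoly.eval y < 0 := by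
    intro x y hxy hneg
    have e : (x * y) ^ (n + γ.length + γ'.length) * (A.charpoly.eval x * A.charpoly.eval y) =
        (x * y) ^ (n + n) * (((x ^ γ.length - s ^ γ.length) * (y ^ γ.length - s ^ γ.length)) *
          ((x ^ γ'.length - (4 * s') ^ γ'.length) * (y ^ γ'.length - (4 * s') ^ γ'.length))) := by
      rw [mul_pow, mul_mul_mul_comm, hf, hf]
      ring
    have e2 := congrArg SignType.sign e
    rw [sign_mul, sign_pos (pow_pos hxy _), one_mul, sign_mul (_ ^ _), sign_pos (pow_pos hxy _),
      one_mul, sign_mul (_ * _) (_ * _), sign_pow_sub_mul_pow_sub ho, sign_pow_sub_mul_pow_sub ho',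
      ← sign_mul, sign_neg hneg] at e2
    exact sign_eq_neg_one_iff.1 e2
  have hsub : P.IsSubordinate A := (γ.isSubordinate_weightedMatrix zero_le_one).add
    (γ'.isSubordinate_weightedMatrix (by norm_num))
  have hmain : P.detSign = SignType.sign (s / 2) * SignType.sign (3 * s') := by
    apply detSign_eq_of_sign_changes hns hP hsub (u := s / 2) (v := 2 * s) (u' := 3 * s')
      (v' := 8 * s')
    · rcases hs1 with h | h <;> rw [h] <;> norm_num
    · rcases hs1' with h | h <;> rw [h] <;> norm_num
    · rw [Set.disjoint_left]
      intro y hy hy'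
      rw [Set.mem_uIcc] at hy hy'
      rcases hs1 with h | h <;> rcases hs1' with h' | h' <;> rw [h] at hy <;> rw [h'] at hy' <;>
        rcases hy with hy | hy <;> rcases hy' with hy' | hy' <;> linarith [hy.1, hy.2, hy'.1, hy'.2]
    · apply hsign
      · rcases hs1 with h | h <;> rw [h] <;> norm_num
      · rcases hs1 with h | h <;> rcases hs1' with h' | h' <;> rw [h, h'] <;> norm_num
    · apply hsign
      · rcases hs1' with h | h <;> rw [h] <;> norm_num
      · rcases hs1 with h | h <;> rcases hs1' with h' | h' <;> rw [h, h'] <;> norm_num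
  rw [hmain, div_eq_mul_inv, sign_mul, sign_mul, sign_pos (show (0 : ℝ) < 2⁻¹ by norm_num),
    sign_pos (show (0 : ℝ) < 3 by norm_num), mul_one, one_mul, sign_cast_real, sign_cast_real]

end SimpleCycle

end SignPattern

namespace Matrix

/-- The case x = 0 of `det_scalar_sub_cyclic`; it explains the factor in `SimpleCycle.sign`. -/
theorem det_cyclic {R : Type*} [CommRing R] {k : ℕ} (hk : 0 < k) (w : Fin k → R) :
    (Matrix.of fun a b => if b = finRotate k a then w a else 0).det
      = (-1) ^ (k - 1) * ∏ a, w a := by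
  have h := det_scalar_sub_cyclic hk w 0
  rw [map_zero, zero_sub, det_neg, Fintype.card_fin, zero_pow hk.ne', zero_sub] at h
  obtain ⟨k, rfl⟩ : ∃ m, k = m + 1 := ⟨k - 1, by omega⟩
  have h2 := congrArg (fun y => (-1) ^ (k + 1) * y) h
  simp only [← mul_assoc, ← mul_pow] at h2
  rw [neg_one_mul, neg_neg, one_pow, one_mul] at h2
  rw [h2, Nat.add_sub_cancel, pow_succ]
  ring

end Matrix

/-! ### Orbits of a permutation as cycles. -/

namespace Equiv.Perm

open Function

variable {α : Type*} (σ : Equiv.Perm α)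

theorem minimalPeriod_pos [Finite α] (i : α) : 0 < minimalPeriod σ i := by
  apply minimalPeriod_pos_of_mem_periodicPts
  have := Fintype.ofFinite α
  exact mk_mem_periodicPts (orderOf_pos σ) (by
    rw [IsPeriodicPt, IsFixedPt, Equiv.Perm.iterate_eq_pow, pow_orderOf_eq_one]
    rfl)

/-- The points `i, σ i, σ² i, …`, up to the period of `i`. -/
def orbitPoint (i : α) (a : Fin (minimalPeriod σ i)) : α := σ^[a] i

theorem orbitPoint_injective (i : α) : Injective (σ.orbitPoint i) := fun a b h =>
  Fin.ext ((iterate_eq_iterate_iff_of_lt_minimalPeriod a.2 b.2).1 h)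

theorem orbitPoint_finRotate (i : α) (a : Fin (minimalPeriod σ i)) :
    σ.orbitPoint i (finRotate _ a) = σ (σ.orbitPoint i a) := by
  rw [orbitPoint, val_finRotate, iterate_mod_minimalPeriod_eq, iterate_succ_apply', orbitPoint]

theorem mem_range_orbitPoint [Finite α] {i j : α} :
    j ∈ Set.range (σ.orbitPoint i) ↔ ∃ m : ℕ, σ^[m] i = j := by
  constructor
  · rintro ⟨a, rfl⟩
    exact ⟨a, rfl⟩
  · rintro ⟨m, rfl⟩
    exact ⟨⟨m % minimalPeriod σ i, Nat.mod_lt _ (σ.minimalPeriod_pos i)⟩,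
      iterate_mod_minimalPeriod_eq⟩

theorem iterate_mem_range_orbitPoint [Finite α] {i j : α} (m : ℕ) :
    σ^[m] j ∈ Set.range (σ.orbitPoint i) ↔ j ∈ Set.range (σ.orbitPoint i) := by
  rw [mem_range_orbitPoint, mem_range_orbitPoint]
  constructor
  · rintro ⟨l, hl⟩
    refine ⟨(minimalPeriod σ j - 1) * m + l, ?_⟩
    rw [iterate_add_apply, hl, ← iterate_add_apply]
    obtain ⟨k, hk⟩ : ∃ k, minimalPeriod σ j = k + 1 :=
      ⟨minimalPeriod σ j - 1, by have := σ.minimalPeriod_pos j; omega⟩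
    have : (minimalPeriod σ j - 1) * m + m = minimalPeriod σ j * m := by
      rw [hk, Nat.add_sub_cancel]; ring
    rw [this]
    exact (isPeriodicPt_minimalPeriod σ j).mul_const m
  · rintro ⟨l, rfl⟩
    exact ⟨m + l, iterate_add_apply _ _ _ _⟩

theorem disjoint_range_orbitPoint [Finite α] {i j : α} (h : j ∉ Set.range (σ.orbitPoint i)) :
    _root_.Disjoint (Set.range (σ.orbitPoint i)) (Set.range (σ.orbitPoint j)) := by
  rw [Set.disjoint_right]
  rintro _ ⟨b, rfl⟩ hb
  exact h ((σ.iterate_mem_range_orbitPoint b).1 hb)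

/-- On a set of even size, orbits of odd length do not come alone. -/
theorem exists_odd_minimalPeriod [Finite α] (heven : Even (Nat.card α)) {i : α}
    (hi : Odd (minimalPeriod σ i)) :
    ∃ j, j ∉ Set.range (σ.orbitPoint i) ∧ Odd (minimalPeriod σ j) := by
  classical
  have := Fintype.ofFinite α
  let p : α → Prop := fun j => j ∉ Set.range (σ.orbitPoint i)
  have hp : ∀ x, p (σ x) ↔ p x := fun x => not_congr (σ.iterate_mem_range_orbitPoint 1)
  let τ : Equiv.Perm {j // p j} := σ.subtypePerm hp
  have hcard : ¬ 2 ∣ Fintype.card {j // p j} := by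
    have h1 : Fintype.card {j // j ∈ Set.range (σ.orbitPoint i)} = minimalPeriod σ i := by
      exact (Fintype.card_congr (Equiv.ofInjective _ (σ.orbitPoint_injective i))).symm.trans
        (Fintype.card_fin _)
    have h2 := Fintype.card_subtype_compl (fun j => j ∈ Set.range (σ.orbitPoint i))
    have h3 := Fintype.card_subtype_le (fun j => j ∈ Set.range (σ.orbitPoint i))
    rw [Nat.card_eq_fintype_card] at heven
    rw [h1] at h2 h3
    change ¬ 2 ∣ Fintype.card {j // ¬ j ∈ Set.range (σ.orbitPoint i)}
    rw [h2, ← even_iff_two_dvd, Nat.even_sub h3, ← Nat.not_odd_iff_even (n := minimalPeriod σ i)]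
    tauto
  -- With o the odd part of the order, `τ ^ o` has 2-power order on a set of odd size, so it fixes a
  -- point, whose period divides o.
  obtain ⟨e, o, ho, heo⟩ := Nat.exists_eq_two_pow_mul_odd (orderOf_pos τ).ne'
  have hτ : (τ ^ o) ^ 2 ^ e = 1 := by
    rw [← pow_mul, mul_comm, ← heo, pow_orderOf_eq_one]
  have : Fact (Nat.Prime 2) := ⟨Nat.prime_two⟩
  obtain ⟨⟨j, hj⟩, hfix⟩ := Equiv.Perm.exists_fixed_point_of_prime hcard hτ
  refine ⟨j, hj, Odd.of_dvd_nat ho ?_⟩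
  apply IsPeriodicPt.minimalPeriod_dvd
  rw [IsPeriodicPt, IsFixedPt, Equiv.Perm.iterate_eq_pow]
  rw [subtypePerm_pow] at hfix
  exact congrArg Subtype.val hfix

end Equiv.Perm

/-! ### A negative even cycle or two disjoint odd cycles. -/

namespace SignPattern

open Function

variable {n : ℕ} {P : SignPattern n}

/-- The cycle of the signed digraph through `i` of a permutation along nonzero entries. -/
noncomputable def orbitCycle (σ : Equiv.Perm (Fin n)) (hσ : ∀ i, P i (σ i) ≠ 0) (i : Fin n) : SimpleCycle P where
  length := minimalPeriod σ i
  length_pos := σ.minimalPeriod_pos i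
  vertex := σ.orbitPoint i
  vertex_injective := σ.orbitPoint_injective i
  edge_ne_zero a := by
    rw [σ.orbitPoint_finRotate]
    exact hσ _

theorem prod_mul_iterate_eq (σ : Equiv.Perm (Fin n)) {x : ℝ} {v : Fin n → ℝ}
    (h : ∀ i, ((P i (σ i) : SignType) : ℝ) * v (σ i) = x * v i) (i : Fin n) (k : ℕ) :
    (∏ a ∈ Finset.range k, ((P (σ^[a] i) (σ (σ^[a] i)) : SignType) : ℝ)) * v (σ^[k] i) =
      x ^ k * v i := by
  induction k with
  | zero => simp
  | succ k ih =>
    rw [Finset.prod_range_succ, iterate_succ_apply', mul_assoc, h, mul_left_comm, ih, pow_succ]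
    ring

/-- Following the eigenvector equation once round the orbit returns to `v i`, which cancels. -/
theorem edgeProd_orbitCycle (σ : Equiv.Perm (Fin n)) (hσ : ∀ i, P i (σ i) ≠ 0) {x : ℝ}
    {v : Fin n → ℝ} (h : ∀ i, ((P i (σ i) : SignType) : ℝ) * v (σ i) = x * v i) {i : Fin n}
    (hi : v i ≠ 0) :
    (((orbitCycle σ hσ i).edgeProd : SignType) : ℝ) = x ^ minimalPeriod σ i := by
  have h1 := prod_mul_iterate_eq σ h i (minimalPeriod σ i)
  rw [iterate_minimalPeriod] at h1
  rw [← mul_right_cancel₀ hi h1, SimpleCycle.edgeProd, cast_prod,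
    ← Fin.prod_univ_eq_prod_range (fun a => ((P (σ^[a] i) (σ (σ^[a] i)) : SignType) : ℝ))]
  refine Finset.prod_congr rfl fun a _ => ?_
  congr 2
  exact σ.orbitPoint_finRotate i a

theorem IsSignNonsingular.exists_perm (hns : P.IsSignNonsingular) :
    ∃ σ : Equiv.Perm (Fin n), ∀ i, P i (σ i) ≠ 0 := by
  have h := hns _ P.toReal_mem
  rw [← Matrix.det_transpose, Matrix.det_apply'] at h
  obtain ⟨σ, -, hσ⟩ := Finset.exists_ne_zero_of_sum_ne_zero h
  refine ⟨σ, fun i hi => hσ ?_⟩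
  rw [Finset.prod_eq_zero (Finset.mem_univ i) (by simp [toReal, hi]), mul_zero]

theorem exists_negative_even_or_disjoint_odd (hns : P.IsSignNonsingular)
    (hP : P.IsConsistentOf 2) :
    (∃ γ : SimpleCycle P, Even γ.length ∧ γ.sign = -1) ∨
      (∃ γ₁ γ₂ : SimpleCycle P,
        Odd γ₁.length ∧ Odd γ₂.length ∧ Disjoint γ₁.support γ₂.support) := by
  obtain ⟨σ, hσ⟩ := hns.exists_perm
  have hA : P.IsSubordinate
      (Matrix.of fun i j => if j = σ i then ((P i j : SignType) : ℝ) else 0) := fun i j => by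
    refine ⟨if j = σ i then 1 else 0, by split_ifs <;> simp, ?_⟩
    simp
  obtain ⟨x, v, hv, hxv⟩ := exists_eigenvector_of_isSubordinate hP hA
  have h : ∀ i, ((P i (σ i) : SignType) : ℝ) * v (σ i) = x * v i := fun i => by
    have := congrFun hxv i
    simpa [Matrix.mulVec, dotProduct] using this
  obtain ⟨i, hi⟩ := Function.ne_iff.1 hv
  have hprod := edgeProd_orbitCycle σ hσ h hi
  rcases Nat.even_or_odd (minimalPeriod σ i) with he | ho
  · refine Or.inl ⟨orbitCycle σ hσ i, he, ?_⟩
    rw [SimpleCycle.sign_of_even he]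
    rcases (orbitCycle σ hσ i).edgeProd_eq_one_or with h1 | h1
    · rw [h1]
    · rw [h1] at hprod
      -- An even power of x cannot be -1.
      have := he.pow_nonneg x
      rw [← hprod] at this
      norm_num at this
  · obtain ⟨j, hj, hjo⟩ := σ.exists_odd_minimalPeriod (by simpa using hP.even_of_two) ho
    exact Or.inr ⟨orbitCycle σ hσ i, orbitCycle σ hσ j, ho, hjo, σ.disjoint_range_orbitPoint hj⟩

/-! ### Composite cycles through all vertices. -/

namespace CompositeCycle

theorem vertex_bijective {Γ : CompositeCycle P} (h : Γ.length = n) :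
    Bijective fun x : (Σ p, Fin (Γ.cycle p).length) => (Γ.cycle x.1).vertex x.2 := by
  rw [Fintype.bijective_iff_injective_and_card]
  constructor
  · rintro ⟨p, a⟩ ⟨q, b⟩ hab
    obtain rfl : p = q := by
      by_contra hpq
      exact Set.disjoint_left.1 (Γ.disjoint p q hpq) ⟨a, rfl⟩ ⟨b, hab.symm⟩
    have : a = b := (Γ.cycle p).vertex_injective hab
    rw [this]
  · simpa [length] using h

/-- A composite cycle through all vertices has the sign of the determinant. -/
theorem sign_eq_detSign (hns : P.IsSignNonsingular) {Γ : CompositeCycle P} (h : Γ.length = n) :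
    Γ.sign = P.detSign := by
  let e := Equiv.ofBijective _ (vertex_bijective h)
  have he : ∀ x, e x = (Γ.cycle x.1).vertex x.2 := fun _ => rfl
  let next : (Σ p, Fin (Γ.cycle p).length) → Σ p, Fin (Γ.cycle p).length :=
    fun x => ⟨x.1, finRotate _ x.2⟩
  let A : Matrix (Fin n) (Fin n) ℝ := Matrix.of fun i j =>
    if e.symm j = next (e.symm i) then ((P i j : SignType) : ℝ) else 0
  have hAe : ∀ x y, A (e x) (e y) = if y = next x then ((P (e x) (e y) : SignType) : ℝ) else 0 :=
    fun x y => by simp [A]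
  have hA : P.IsSubordinate A := fun i j => by
    refine ⟨if e.symm j = next (e.symm i) then 1 else 0, by split_ifs <;> simp, ?_⟩
    simp [A]
  -- Indexed by cycle and position, `A` is block diagonal with cyclic blocks.
  have htri : (A.submatrix e e).BlockTriangular Sigma.fst := by
    intro x y hxy
    rw [Matrix.submatrix_apply, hAe, if_neg]
    rintro rfl
    exact lt_irrefl _ hxy
  have hdet : A.det = ((Γ.sign : SignType) : ℝ) := by
    rw [← Matrix.det_submatrix_equiv_self e, htri.det_fintype, CompositeCycle.sign, cast_prod]
    refine Finset.prod_congr rfl fun p _ => ?_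
    rw [SimpleCycle.sign, SignType.coe_mul, SignType.coe_pow, cast_prod, SignType.coe_neg_one,
      ← Matrix.det_cyclic (Γ.cycle p).length_pos,
      ← Matrix.det_submatrix_equiv_self (Equiv.sigmaSubtype p).symm]
    congr 1
    ext a b
    have hab : (⟨p, b⟩ : Σ p, Fin (Γ.cycle p).length) = next ⟨p, a⟩ ↔ b = finRotate _ a := by
      simp only [next, Sigma.mk.injEq, heq_eq_eq, true_and]
    refine (hAe ⟨p, a⟩ ⟨p, b⟩).trans ?_
    simp only [hab, Matrix.of_apply, he]
    split_ifs with h1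
    · rw [h1]
    · rfl
  have hne : Γ.sign ≠ 0 := by
    refine Finset.prod_ne_zero_iff.2 fun p _ => ?_
    rw [SimpleCycle.sign]
    refine mul_ne_zero (pow_ne_zero _ (by decide)) ?_
    exact Finset.prod_ne_zero_iff.2 fun a _ => (Γ.cycle p).edge_ne_zero a
  rw [← hns.sign_det_of_isSubordinate hA, hdet, sign_cast_real]
  rw [hdet]
  intro h0
  apply hne
  rw [← sign_cast_real Γ.sign, h0, sign_zero]

theorem exists_ne_odd {Γ : CompositeCycle P} (h : Even Γ.length) {p : Fin Γ.card}
    (hp : Odd (Γ.cycle p).length) : ∃ q, q ≠ p ∧ Odd (Γ.cycle q).length := by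
  by_contra! hc
  rw [length, ← Finset.add_sum_erase _ _ (Finset.mem_univ p)] at h
  have h2 : Even (∑ q ∈ Finset.univ.erase p, (Γ.cycle q).length) :=
    Finset.even_sum _ fun q hq => Nat.not_odd_iff_even.1 (hc q (Finset.ne_of_mem_erase hq))
  exact Nat.not_even_iff_odd.2 (hp.add_even h2) h

end CompositeCycle

end SignPattern

theorem theorem5p7 {n : ℕ} (P : SignPattern n) (hns : P.IsSignNonsingular)
    (hP : P.IsConsistentOf 2) :
    (∀ Γ₁ Γ₂ : SignPattern.CompositeCycle P,
      Γ₁.length = n → Γ₂.length = n → Γ₁.sign = Γ₂.sign) ∧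
    ((∃ γ : SignPattern.SimpleCycle P, Even γ.length ∧ γ.sign = -1) ∨
      (∃ γ₁ γ₂ : SignPattern.SimpleCycle P,
        Odd γ₁.length ∧ Odd γ₂.length ∧ Disjoint γ₁.support γ₂.support)) ∧
    ((∃ γ : SignPattern.SimpleCycle P, Even γ.length ∧ γ.sign = -1) →
      ¬ ∃ γ₁ γ₂ : SignPattern.SimpleCycle P,
        Odd γ₁.length ∧ Odd γ₂.length ∧ γ₁.sign = γ₂.sign ∧
          Disjoint γ₁.support γ₂.support) ∧
    (∀ Γ : SignPattern.CompositeCycle P, Γ.length = n →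
      ∀ p, Odd (Γ.cycle p).length →
        ∀ γ₁ : SignPattern.SimpleCycle P, Odd γ₁.length →
          γ₁.support ⊆ (Γ.cycle p).support → γ₁.sign = (Γ.cycle p).sign) := by
  refine ⟨fun Γ₁ Γ₂ h₁ h₂ => ?_, SignPattern.exists_negative_even_or_disjoint_odd hns hP, ?_, ?_⟩
  · rw [SignPattern.CompositeCycle.sign_eq_detSign hns h₁,
      SignPattern.CompositeCycle.sign_eq_detSign hns h₂]
  · rintro ⟨γ, he, hγ⟩ ⟨γ₁, γ₂, h₁, h₂, hs, hd⟩
    have h3 := SignPattern.SimpleCycle.detSign_eq_neg_one_of_even hns hP he hγ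
    rw [SignPattern.SimpleCycle.detSign_eq_of_odd hns hP h₁ h₂ hd, hs] at h3
    -- A square in `SignType` is never -1.
    revert h3
    generalize γ₂.sign = s
    decide +revert
  · intro Γ hΓ p hp γ₁ h₁ hsub
    obtain ⟨q, hqp, hq⟩ :=
      SignPattern.CompositeCycle.exists_ne_odd (by rw [hΓ]; exact hP.even_of_two) hp
    have hd := Γ.disjoint p q hqp.symm
    have e₁ := SignPattern.SimpleCycle.detSign_eq_of_odd hns hP hp hq hd
    -- The odd factor q is disjoint from both cycles, so its nonzero sign cancels between `e₁` and
    -- `e₂`.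
    have e₂ := SignPattern.SimpleCycle.detSign_eq_of_odd hns hP h₁ hq (hd.mono_left hsub)
    have h0 := hns.detSign_ne_zero
    revert e₁ e₂ h0
    generalize P.detSign = d, γ₁.sign = s, (Γ.cycle p).sign = s', (Γ.cycle q).sign = s''
    decide +revert
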